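/- All fusion categories are over $\mathbb{C}$ (a fusion category is a $\mathbb{C}$-linear abelian semisimple rigid monoidal category with $\mathbb{C}$-bilinear tensor product, finitely many isomorphism classes of simple objects, finite-dimensional spaces of morphisms and simple unit object). For a fusion category $\mathcal{C}$ let $\Lambda_{\mathcal{C}}$ be the set of isomorphism classes of simple objects, let $[X]=\sum_{S\in\Lambda_{\mathcal{C}}}\dim\mathrm{Hom}_{\mathcal{C}}(S,X)\,[S]$ be the class of an object $X$ in $K_0(\mathcal{C})\otimes_{\mathbb{Z}}\mathbb{C}$, and let $\mathrm{FPdim}(X)$ be the Frobenius–Perron eigenvalue (the largest nonnegative real eigenvalue) of left multiplication by $[X]$ on the Grothendieck ring. Let $F:\mathcal{C}\to\mathcal{D}$ be a tensor functor (a $\mathbb{C}$-linear strong monoidal functor) between fusion categories, with right adjoint $R$. Suppose that $F$ is normal, that is, for every simple object $X$ of $\mathcal{C}$, if $\mathrm{Hom}_{\mathcal{D}}(1,F(X))\neq 0$, then $F(X)\cong 1^{\oplus \mathrm{FPdim}(X)}$. For $X,X'\in\Lambda_{\mathcal{C}}$ write $X\sim^F X'$ if $F(X)$ and $F(X')$ have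 a common simple factor, and for $Y,Y'\in\Lambda_{\mathcal{D}}$ write $Y\sim_F Y'$ if $R(Y)$ and $R(Y')$ have a common simple factor. Let $\approx^F$ on $\Lambda_{\mathcal{C}}$ and $\approx_F$ on $\Lambda_{\mathcal{D}}$ be the equivalence relations generated by $\sim^F$ and $\sim_F$; thus $X\approx^F X'$ iff there is a sequence $X=X_1\sim^F X_2\sim^F\cdots\sim^F X_n=X'$ with $n\ge 1$, and similarly for $\approx_F$. 1) For all simple objects $X,X'$ of $\mathcal{C}$, $$X\approx^F X'\iff \frac{[F(X)]}{\mathrm{FPdim}(X)}=\frac{[F(X')]}{\mathrm{FPdim}(X')}\quad\text{in } K_0(\mathcal{D})\otimes\mathbb{C}.$$ 2) For all simple objects $Y,Y'$ of $\mathcal{D}$, if $Y\approx_F Y'$, then $$\frac{[R(Y)]}{\mathrm{FPdim}(Y)}=\frac{[R(Y')]}{\mathrm{FPdim}(Y')}\quad\text{in } K_0(\mathcal{C})\otimes\mathbb{C},$$ and, provided that $R(Y)$ and $R(Y')$ are not both zero (equivalently, at least one of $Y,Y'$ is a simple factor of some $F(X)$; this is automatic if $F$ is dominant), $Y\approx_F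 Y'$ holds if and only if this equality holds. -/

import Mathlib

open CategoryTheory MonoidalCategory Limits

universe v u v₁ v₂ u₁ u₂

noncomputable section

namespace FusionImage

attribute [local instance] Abelian.hasFiniteBiproducts

/-- `Λ_C`: the set of isomorphism classes of simple objects of `C`. -/
def SimpleClass (C : Type u) [Category.{v} C] [HasZeroMorphisms C] : Type u :=
  {q : Quotient (isIsomorphicSetoid C) // ∃ X : C, Simple X ∧ Quotient.mk _ X = q}

section Simple

variable {C : Type u} [Category.{v} C] [HasZeroMorphisms C]

/-- The isomorphism class of a simple object. -/
def SimpleClass.mk (X : C) [h : Simple X] : SimpleClass C :=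
  ⟨Quotient.mk _ X, X, h, rfl⟩

/-- A simple object representing a given isomorphism class. -/
def SimpleClass.rep (S : SimpleClass C) : C := S.2.choose

instance (S : SimpleClass C) : Simple S.rep := S.2.choose_spec.1

theorem SimpleClass.mk_rep (S : SimpleClass C) : SimpleClass.mk S.rep = S :=
  Subtype.ext S.2.choose_spec.2

/-- The set of simple factors of an object `Z`, i.e. the classes of simple objects that embed
into `Z`. (It is used in semisimple categories, where subobjects are direct summands.) -/
def simpleFactors (Z : C) : Set (SimpleClass C) :=
  {S | ∃ f : S.rep ⟶ Z, Mono f}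

end Simple

/-- A fusion category over `ℂ`: a `ℂ`-linear abelian rigid monoidal category with bilinear tensor
product which is semisimple (every object is a finite direct sum of simple objects), has finitely
many isomorphism classes of simple objects, finite dimensional spaces of morphisms and a simple
unit object. -/
class IsFusionCategory (C : Type u) [Category.{v} C] [Abelian C] [Linear ℂ C]
    [MonoidalCategory C] [MonoidalPreadditive C] [MonoidalLinear ℂ C] [RigidCategory C] :
    Prop where
  finiteDimensional_hom : ∀ X Y : C, FiniteDimensional ℂ (X ⟶ Y)
  simple_unit : Simple (𝟙_ C)
  finite_simpleClass : Finite (SimpleClass C)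
  semisimple : ∀ X : C, ∃ (n : ℕ) (S : Fin n → C), (∀ i, Simple (S i)) ∧ Nonempty (X ≅ ⨁ S)

attribute [instance] IsFusionCategory.finiteDimensional_hom IsFusionCategory.simple_unit
  IsFusionCategory.finite_simpleClass

section Grothendieck

variable {C : Type u} [Category.{v} C] [Abelian C] [Linear ℂ C]
    [MonoidalCategory C] [MonoidalPreadditive C] [MonoidalLinear ℂ C] [RigidCategory C]

/-- The space `K₀(C) ⊗ ℂ` of virtual objects: formal complex linear combinations of isomorphism
classes of simple objects. -/
abbrev VirtualObject (C : Type u) [Category.{v} C] [HasZeroMorphisms C] : Type u :=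
  SimpleClass C →₀ ℂ

variable [IsFusionCategory C]

/-- The class `[X] = ∑_S dim Hom(S, X) [S]` of an object `X` in `K₀(C) ⊗ ℂ`. -/
def objClass (X : C) : VirtualObject C :=
  Finsupp.equivFunOnFinite.symm fun S => (Module.finrank ℂ (S.rep ⟶ X) : ℂ)

/-- Left multiplication by `[X]` on the Grothendieck ring, `[S] ↦ [X ⊗ S]`, extended linearly
to `K₀(C) ⊗ ℂ`. -/
def leftMul (X : C) : Module.End ℂ (VirtualObject C) :=
  Finsupp.linearCombination ℂ fun S : SimpleClass C => objClass (X ⊗ S.rep)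

/-- The Frobenius-Perron dimension of `X`: the Frobenius-Perron eigenvalue, i.e. the largest
nonnegative real eigenvalue, of left multiplication by `[X]` on the Grothendieck ring. -/
def FPdim (X : C) : ℝ :=
  sSup {t : ℝ | 0 ≤ t ∧ (leftMul X).HasEigenvalue (t : ℂ)}

end Grothendieck

section Functors

/-- For `X, X'` in `Λ_A`: the objects `G(X)` and `G(X')` have a common simple factor.
For `G = F` this is the relation `∼^F`, and for `G = R`, a right adjoint of `F`, it is `∼_F`. -/
def Linked {A : Type u₁} [Category.{v₁} A] [HasZeroMorphisms A]
    {B : Type u₂} [Category.{v₂} B] [HasZeroMorphisms B]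
    (G : A ⥤ B) (X X' : SimpleClass A) : Prop :=
  (simpleFactors (G.obj X.rep) ∩ simpleFactors (G.obj X'.rep)).Nonempty

/-- There is a finite sequence `X = X₁, …, Xₙ = X'` (`n ≥ 1`) in `Λ_A` in which any two consecutive
terms are linked by `G`. For `G = F` this is `≈^F`, and for `G = R` it is `≈_F`. -/
def LinkEquiv {A : Type u₁} [Category.{v₁} A] [HasZeroMorphisms A]
    {B : Type u₂} [Category.{v₂} B] [HasZeroMorphisms B]
    (G : A ⥤ B) : SimpleClass A → SimpleClass A → Prop :=
  Relation.ReflTransGen (Linked G)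

variable {C : Type u₁} [Category.{v₁} C] [Abelian C] [Linear ℂ C]
    [MonoidalCategory C] [MonoidalPreadditive C] [MonoidalLinear ℂ C] [RigidCategory C]
    [IsFusionCategory C]
    {D : Type u₂} [Category.{v₂} D] [Abelian D] [Linear ℂ D] [MonoidalCategory D]

/-- `F` is normal: if `dim Hom(1, F(X)) > 0` for a simple object `X`, then `F(X)` is isomorphic to
the direct sum of `FPdim(X)` copies of the unit object. -/
def IsNormalFunctor (F : C ⥤ D) : Prop :=
  ∀ (X : C) [Simple X], 0 < Module.finrank ℂ (𝟙_ D ⟶ F.obj X) →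
    ∃ n : ℕ, (n : ℝ) = FPdim X ∧ Nonempty (F.obj X ≅ ⨁ fun _ : Fin n => 𝟙_ D)

end Functors

end FusionImage

end

/-!
Everything happens at the level of the dimensions `homDim X Y = dim Hom(X, Y)`, a symmetric form on
`K₀` for which the simple objects are orthonormal. Write `N` for the Frobenius-Perron dimension of
`R 𝟙`.

Since `[R 𝟙] = ∑ homDim (F S) 𝟙 [S]`, normality of `F` makes `F (R 𝟙)` a sum of `N` copies of the
unit object (`IsAdditive.map_rightAdjoint_unit`). With the projection formula `R (F X ⊗ Z) = X ⊗ R Z`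
this gives `[F R F X] = N [F X]` and, by adjunction, `[R F R Y] = N [R Y]`. Expanding `R F X` in
simple objects, the first identity reads `∑ homDim (F X) (F X') [F X'] = N [F X]`, and as
`FPdim (F X) = FPdim X`, also `∑ homDim (F X) (F X') FPdim X' = N FPdim X`. So each coordinate of
`[F X]` and the positive vector `FPdim` are eigenvectors, for the same eigenvalue, of a symmetric
nonnegative matrix whose nonzero entries are exactly the linked pairs. The vanishing of a Dirichlet
form (`div_eq_div_of_symmetric`) shows that `[F X] / FPdim X` agrees for linked `X`. Conversely, two
nonzero proportional classes share a simple factor, so the objects are linked directly.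

For `R` the same argument shows that `[R Y] / FPdim (R Y)` agrees for linked `Y`, and it remains to
see that `FPdim (R Y) = N FPdim Y` if `R Y` is nonzero (`FPdim_rightAdjoint`). By the projection
formula both sides, as functions of `Y`, are multiplied by `FPdim X` when `Y` is replaced by
`F X ⊗ Y`, so a maximum argument for their quotient applies.

That `FPdim` is additive, multiplicative and positive on simple objects follows from the
Perron-Frobenius theorem for the sum of all right multiplications by simple objects: its
Perron-Frobenius vector is unique up to scaling, hence a common eigenvector of all left
multiplications (`exists_isAdditive_FPdim_mul`), and a positive left eigenvector detects the spectral
radius (`FPdim_eq_of_isAdditive`).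
-/

noncomputable section

namespace FusionImage

-- Sums over `SimpleClass C` use the `Fintype` structure given by its finiteness.
attribute [local instance] Abelian.hasFiniteBiproducts Fintype.ofFinite

/-! ### Positive and symmetric matrices -/

/-- The existence part of the Perron-Frobenius theorem. The vector is `A x` where `x` maximizes the
Collatz-Wielandt quotient `min_i (A A x)_i / (A x)_i` on the standard simplex. -/
theorem exists_pos_eigenvector {ι : Type*} [Fintype ι] [Nonempty ι] (A : ι → ι → ℝ)
    (hA : ∀ i j, 0 < A i j) :
    ∃ (w : ι → ℝ) (r : ℝ), (∀ i, 0 < w i) ∧ ∀ i, ∑ j, A i j * w j = r * w i := by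
  classical
  set T : (ι → ℝ) → ι → ℝ := fun x i => ∑ j, A i j * x j with hT
  have hTc : ∀ i, Continuous fun x => T x i := fun i => by
    simp only [hT]; fun_prop
  have hTpos : ∀ x : ι → ℝ, (∀ j, 0 ≤ x j) → (∃ j, x j ≠ 0) → ∀ i, 0 < T x i := by
    rintro x hx ⟨j, hj⟩ i
    exact Finset.sum_pos' (fun k _ => mul_nonneg (hA i k).le (hx k))
      ⟨j, Finset.mem_univ _, mul_pos (hA i j) (lt_of_le_of_ne (hx j) hj.symm)⟩
  have hne : (stdSimplex ℝ ι).Nonempty :=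
    ⟨_, single_mem_stdSimplex ℝ (Classical.arbitrary ι)⟩
  have hsimp : ∀ x ∈ stdSimplex ℝ ι, ∃ j, x j ≠ 0 := by
    intro x hx
    by_contra! h
    have := hx.2
    simp [h] at this
  have hpos1 : ∀ x ∈ stdSimplex ℝ ι, ∀ i, 0 < T x i := fun x hx =>
    hTpos x hx.1 (hsimp x hx)
  set g : (ι → ℝ) → ℝ := fun x =>
    Finset.univ.inf' Finset.univ_nonempty fun i => T (T x) i / T x i with hg
  have hgc : ContinuousOn g (stdSimplex ℝ ι) := by
    apply ContinuousOn.finset_inf'_apply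
    intro i _
    refine ContinuousOn.div ?_ (hTc i).continuousOn fun x hx => (hpos1 x hx i).ne'
    exact ((hTc i).comp (continuous_pi hTc)).continuousOn
  obtain ⟨x, hx, hmax⟩ := (isCompact_stdSimplex ℝ ι).exists_isMaxOn hne hgc
  have hy := hpos1 x hx
  have hle : ∀ i, g x * T x i ≤ T (T x) i := fun i => by
    rw [← le_div_iff₀ (hy i)]
    exact Finset.inf'_le _ (Finset.mem_univ i)
  refine ⟨T x, g x, hy, ?_⟩
  by_contra! hcon
  obtain ⟨i₀, hi₀⟩ := hcon
  have hlin : ∀ (c : ℝ) (a b : ι → ℝ) i, T (fun j => a j - c * b j) i = T a i - c * T b i := by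
    intro c a b i
    simp only [hT, Finset.mul_sum, ← Finset.sum_sub_distrib]
    exact Finset.sum_congr rfl fun j _ => by ring
  -- If `A y ≥ r y` is not an equality for `y = A x`, then applying `A` makes it strict
  -- everywhere, and `y` has a larger quotient than `x`.
  have hstrict : ∀ i, g x * T (T x) i < T (T (T x)) i := fun i => by
    have := hTpos (fun j => T (T x) j - g x * T x j) (fun j => sub_nonneg.2 (hle j))
      ⟨i₀, sub_ne_zero.2 hi₀⟩ i
    rw [hlin] at this
    linarith
  set s := ∑ j, T x j with hs
  have hspos : 0 < s := Finset.sum_pos (fun j _ => hy j) Finset.univ_nonempty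
  have hscale : ∀ (c : ℝ) (a : ι → ℝ) i, T (fun j => c * a j) i = c * T a i := by
    intro c a i
    simp only [hT, Finset.mul_sum]
    exact Finset.sum_congr rfl fun j _ => by ring
  have hmem : (fun j => s⁻¹ * T x j) ∈ stdSimplex ℝ ι :=
    ⟨fun j => by have := hy j; positivity, by
      rw [← Finset.mul_sum, ← hs, inv_mul_cancel₀ hspos.ne']⟩
  refine absurd (show g _ ≤ g x from hmax hmem) (not_le.2 ?_)
  rw [hg, Finset.lt_inf'_iff]
  intro i _
  have h1 : T (fun j => s⁻¹ * T x j) = fun j => s⁻¹ * T (T x) j := funext (hscale _ _)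
  rw [h1, hscale, mul_div_mul_left _ _ (inv_ne_zero hspos.ne'),
    lt_div_iff₀ (hTpos _ (fun j => (hy j).le) ⟨i₀, (hy i₀).ne'⟩ i)]
  exact hstrict i

/-- The uniqueness part of the Perron-Frobenius theorem. -/
theorem eq_smul_of_eigenvector {ι : Type*} [Fintype ι] [Nonempty ι] {A : ι → ι → ℝ}
    (hA : ∀ i j, 0 < A i j) {w x : ι → ℝ} {r : ℝ} (hw : ∀ i, 0 < w i)
    (hAw : ∀ i, ∑ j, A i j * w j = r * w i) (hAx : ∀ i, ∑ j, A i j * x j = r * x i) :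
    ∃ c : ℝ, ∀ i, x i = c * w i := by
  obtain ⟨i, hi⟩ := Finite.exists_min fun i => x i / w i
  refine ⟨x i / w i, fun k => ?_⟩
  have hz : ∀ j, 0 ≤ x j - x i / w i * w j := fun j => by
    have := (le_div_iff₀ (hw j)).1 (hi j)
    linarith
  have h0 : ∑ j, A i j * (x j - x i / w i * w j) = 0 := by
    have : ∑ j, A i j * (x j - x i / w i * w j)
        = ∑ j, A i j * x j - x i / w i * ∑ j, A i j * w j := by
      rw [Finset.mul_sum, ← Finset.sum_sub_distrib]
      exact Finset.sum_congr rfl fun j _ => by ring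
    rw [this, hAx, hAw]
    have := (hw i).ne'
    field_simp
    ring
  have := (Finset.sum_eq_zero_iff_of_nonneg fun j _ => mul_nonneg (hA i j).le (hz j)).1 h0 k
    (Finset.mem_univ k)
  rcases mul_eq_zero.1 this with h | h
  · exact absurd h (hA i k).ne'
  · linarith

/-- A nonnegative matrix with a positive left eigenvector for `μ` has no real eigenvalue above `μ`:
if `B z = t z`, then pairing `t |z| ≤ B |z|` with the left eigenvector gives `t ≤ μ`. -/
theorem le_of_pos_left_eigenvector {ι : Type*} [Fintype ι] {B : ι → ι → ℝ}
    (hB : ∀ i j, 0 ≤ B i j) {χ : ι → ℝ} (hχ : ∀ i, 0 < χ i) {μ : ℝ}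
    (h : ∀ j, ∑ i, B i j * χ i = μ * χ j) {t : ℝ} (ht : 0 ≤ t) {z : ι → ℂ} (hz : z ≠ 0)
    (hBz : ∀ i, ∑ j, z j * (B i j : ℂ) = t * z i) : t ≤ μ := by
  have hz1 : ∀ i, t * ‖z i‖ ≤ ∑ j, ‖z j‖ * B i j := fun i =>
    calc t * ‖z i‖ = ‖(t : ℂ) * z i‖ := by
          rw [norm_mul, Complex.norm_real, Real.norm_of_nonneg ht]
      _ = ‖∑ j, z j * (B i j : ℂ)‖ := by rw [hBz]
      _ ≤ ∑ j, ‖z j * (B i j : ℂ)‖ := norm_sum_le _ _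
      _ = _ := Finset.sum_congr rfl fun j _ => by
          rw [norm_mul, Complex.norm_real, Real.norm_of_nonneg (hB i j)]
  have hz2 : t * ∑ i, ‖z i‖ * χ i ≤ μ * ∑ i, ‖z i‖ * χ i :=
    calc t * ∑ i, ‖z i‖ * χ i = ∑ i, t * ‖z i‖ * χ i := by
          simp only [Finset.mul_sum, mul_assoc]
      _ ≤ ∑ i, (∑ j, ‖z j‖ * B i j) * χ i :=
          Finset.sum_le_sum fun i _ => mul_le_mul_of_nonneg_right (hz1 i) (hχ i).le
      _ = ∑ j, ‖z j‖ * ∑ i, B i j * χ i := by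
          simp only [Finset.sum_mul, Finset.mul_sum, mul_assoc]
          exact Finset.sum_comm
      _ = μ * ∑ i, ‖z i‖ * χ i := by
          simp only [h, Finset.mul_sum, mul_left_comm]
  refine le_of_mul_le_mul_right hz2 ?_
  obtain ⟨i, hi⟩ := Function.ne_iff.1 hz
  exact Finset.sum_pos' (fun j _ => mul_nonneg (norm_nonneg _) (hχ j).le)
    ⟨i, Finset.mem_univ _, mul_pos (norm_pos_iff.2 hi) (hχ i)⟩

/-- A discrete maximum principle: if `d` and `g` are eigenvectors for the same eigenvalue of a
symmetric nonnegative matrix `M` and `d ≥ 0`, then `g / d` is constant along the edges of the graph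
of `M`. The reason is that the Dirichlet form `∑ M x y d x d y (g x / d x - g y / d y)²` vanishes. -/
theorem div_eq_div_of_symmetric {ι : Type*} [Fintype ι] {M : ι → ι → ℝ} {d g : ι → ℝ} {N : ℝ}
    (hM : ∀ x y, 0 ≤ M x y) (hsymm : ∀ x y, M x y = M y x) (hd : ∀ x, 0 ≤ d x)
    (hgd : ∀ x, d x = 0 → g x = 0) (hMd : ∀ x, ∑ y, M x y * d y = N * d x)
    (hMg : ∀ x, ∑ y, M x y * g y = N * g x) {x y : ι} (hxy : 0 < M x y) (hx : 0 < d x)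
    (hy : 0 < d y) : g x / d x = g y / d y := by
  have hsq : ∀ x, d x * (g x / d x) ^ 2 * d x = g x ^ 2 := fun x => by
    rcases eq_or_ne (d x) 0 with h | h
    · simp [h, hgd x h]
    · field_simp
  have hdg : ∀ x, d x * (g x / d x) = g x := fun x => by
    rcases eq_or_ne (d x) 0 with h | h
    · simp [h, hgd x h]
    · field_simp
  have key : ∀ x y, M x y * d x * d y * (g x / d x - g y / d y) ^ 2
      = d x * (g x / d x) ^ 2 * (M x y * d y) + d y * (g y / d y) ^ 2 * (M y x * d x)
        - 2 * (g x * (M x y * g y)) := fun x y => by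
    rw [hsymm y x]
    linear_combination (-2 * M x y * (d y * (g y / d y))) * hdg x - 2 * M x y * g x * hdg y
  have h0 : ∑ x, ∑ y, M x y * d x * d y * (g x / d x - g y / d y) ^ 2 = 0 := by
    simp only [key, Finset.sum_sub_distrib, Finset.sum_add_distrib]
    rw [Finset.sum_comm (f := fun x y => d y * (g y / d y) ^ 2 * (M y x * d x))]
    simp only [← Finset.mul_sum, hMd, hMg, ← Finset.sum_add_distrib]
    rw [Finset.mul_sum, ← Finset.sum_sub_distrib]
    refine Finset.sum_eq_zero fun x _ => ?_
    linear_combination 2 * N * hsq x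
  have hnn : ∀ x y, 0 ≤ M x y * d x * d y * (g x / d x - g y / d y) ^ 2 := fun x y => by
    have := hM x y; have := hd x; have := hd y; positivity
  have h1 := (Finset.sum_eq_zero_iff_of_nonneg
    fun x _ => Finset.sum_nonneg fun y _ => hnn x y).1 h0 x (Finset.mem_univ x)
  have h2 := (Finset.sum_eq_zero_iff_of_nonneg fun y _ => hnn x y).1 h1 y (Finset.mem_univ y)
  have h3 : M x y * d x * d y ≠ 0 := by positivity
  exact sub_eq_zero.1 (pow_eq_zero_iff two_ne_zero |>.1 ((mul_eq_zero.1 h2).resolve_left h3))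

/-! ### Additive invariants of objects -/

/-- The dimension of `Hom(X, Y)`, as a real number. -/
def homDim {C : Type u} [Category.{v} C] [Preadditive C] [Linear ℂ C] (X Y : C) : ℝ :=
  Module.finrank ℂ (X ⟶ Y)

/-- A real valued function on objects which is invariant under isomorphism and turns finite direct
sums into sums; equivalently, a homomorphism from `K₀` to `ℝ` if the category is semisimple. -/
structure IsAdditive {C : Type u} [Category.{v} C] [Abelian C] (φ : C → ℝ) : Prop where
  iso : ∀ {X Y : C}, (X ≅ Y) → φ X = φ Y
  biproduct : ∀ {n : ℕ} (S : Fin n → C), φ (⨁ S) = ∑ i, φ (S i)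

section Additive

variable {C : Type u₁} [Category.{v₁} C] [Abelian C]
  {D : Type u₂} [Category.{v₂} D] [Abelian D]

theorem IsAdditive.comp {φ : D → ℝ} (hφ : IsAdditive φ) (G : C ⥤ D) [G.Additive] :
    IsAdditive fun X => φ (G.obj X) where
  iso e := hφ.iso (G.mapIso e)
  biproduct S := (hφ.iso (G.mapBiproduct S)).trans (hφ.biproduct _)

theorem IsAdditive.const_mul {φ : C → ℝ} (hφ : IsAdditive φ) (c : ℝ) :
    IsAdditive fun X => c * φ X where
  iso e := by rw [hφ.iso e]
  biproduct S := by rw [hφ.biproduct, Finset.mul_sum]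

theorem IsAdditive.sub {φ ψ : C → ℝ} (hφ : IsAdditive φ) (hψ : IsAdditive ψ) :
    IsAdditive fun X => φ X - ψ X where
  iso e := by rw [hφ.iso e, hψ.iso e]
  biproduct S := by rw [hφ.biproduct, hψ.biproduct, Finset.sum_sub_distrib]

theorem IsAdditive.sum {ι : Type*} [Fintype ι] {φ : ι → C → ℝ} (hφ : ∀ i, IsAdditive (φ i)) :
    IsAdditive fun X => ∑ i, φ i X where
  iso e := Finset.sum_congr rfl fun i _ => (hφ i).iso e
  biproduct S := by
    simp only [(hφ _).biproduct]
    exact Finset.sum_comm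

theorem IsAdditive.tensor_left [MonoidalCategory C] [MonoidalPreadditive C] {φ : C → ℝ}
    (hφ : IsAdditive φ) (X : C) : IsAdditive fun Z => φ (X ⊗ Z) :=
  hφ.comp (tensorLeft X)

theorem IsAdditive.tensor_right [MonoidalCategory C] [MonoidalPreadditive C] {φ : C → ℝ}
    (hφ : IsAdditive φ) (X : C) : IsAdditive fun Z => φ (Z ⊗ X) :=
  hφ.comp (tensorRight X)

theorem SimpleClass.nonempty_rep_mk_iso (X : C) [Simple X] : Nonempty ((SimpleClass.mk X).rep ≅ X) :=
  Quotient.exact (congrArg Subtype.val (SimpleClass.mk_rep (SimpleClass.mk X)))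

theorem SimpleClass.eq_mk_of_iso {S : SimpleClass C} {X : C} [Simple X] (e : S.rep ≅ X) :
    S = SimpleClass.mk X := by
  rw [← SimpleClass.mk_rep S]
  exact Subtype.ext (Quotient.sound ⟨e⟩)

theorem IsAdditive.map_rep_mk {φ : C → ℝ} (hφ : IsAdditive φ) (X : C) [Simple X] :
    φ (SimpleClass.mk X).rep = φ X :=
  hφ.iso (SimpleClass.nonempty_rep_mk_iso X).some

variable [Linear ℂ C]

theorem homDim_nonneg (X Y : C) : 0 ≤ homDim X Y := Nat.cast_nonneg _

theorem homDim_congr {X Y X' Y' : C} (e : X ≅ X') (f : Y ≅ Y') : homDim X Y = homDim X' Y' := by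
  rw [homDim, homDim, ((Linear.homCongr ℂ e f)).finrank_eq]

theorem homDim_tensor_left [MonoidalCategory C]
    [MonoidalPreadditive C] [MonoidalLinear ℂ C] (X Y Y' Z : C) [ExactPairing Y Y'] :
    homDim (Y' ⊗ X) Z = homDim X (Y ⊗ Z) := by
  have e : (Y' ⊗ X ⟶ Z) ≃ₗ[ℂ] (X ⟶ Y ⊗ Z) :=
    { tensorLeftHomEquiv X Y Y' Z with
      map_add' := fun f g => by simp [tensorLeftHomEquiv]
      map_smul' := fun c f => by simp [tensorLeftHomEquiv] }
  rw [homDim, homDim, e.finrank_eq]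

theorem homDim_tensor_right [MonoidalCategory C]
    [MonoidalPreadditive C] [MonoidalLinear ℂ C] (X Y Y' Z : C) [ExactPairing Y Y'] :
    homDim (X ⊗ Y) Z = homDim X (Z ⊗ Y') := by
  have e : (X ⊗ Y ⟶ Z) ≃ₗ[ℂ] (X ⟶ Z ⊗ Y') :=
    { tensorRightHomEquiv X Y Y' Z with
      map_add' := fun f g => by simp [tensorRightHomEquiv]
      map_smul' := fun c f => by simp [tensorRightHomEquiv] }
  rw [homDim, homDim, e.finrank_eq]

end Additive

section Semisimple

variable {C : Type u} [Category.{v} C] [Abelian C] [Linear ℂ C]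
  [MonoidalCategory C] [MonoidalPreadditive C] [MonoidalLinear ℂ C] [RigidCategory C]
  [IsFusionCategory C]

theorem isAdditive_homDim_right (A : C) : IsAdditive fun B => homDim A B where
  iso e := homDim_congr (Iso.refl A) e
  biproduct {n} S := by
    have e : (A ⟶ ⨁ S) ≃ₗ[ℂ] (∀ i, A ⟶ S i) :=
      { toFun := fun f i => f ≫ biproduct.π S i
        invFun := fun f => biproduct.lift f
        map_add' := fun f g => by ext; simp
        map_smul' := fun c f => by ext; simp
        left_inv := fun f => by ext; simp
        right_inv := fun f => by ext; simp }
    simp only [homDim]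
    rw [e.finrank_eq, Module.finrank_pi_fintype]
    push_cast
    rfl

theorem isAdditive_homDim_left (B : C) : IsAdditive fun A => homDim A B where
  iso e := homDim_congr e (Iso.refl B)
  biproduct {n} S := by
    have e : (⨁ S ⟶ B) ≃ₗ[ℂ] (∀ i, S i ⟶ B) :=
      { toFun := fun f i => biproduct.ι S i ≫ f
        invFun := fun f => biproduct.desc f
        map_add' := fun f g => by ext; simp
        map_smul' := fun c f => by ext; simp
        left_inv := fun f => by ext; simp
        right_inv := fun f => by ext; simp }
    simp only [homDim]
    rw [e.finrank_eq, Module.finrank_pi_fintype]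
    push_cast
    rfl

open Classical in
/-- Schur's lemma. -/
theorem homDim_rep_simple (S : SimpleClass C) (X : C) [Simple X] :
    homDim S.rep X = if S = SimpleClass.mk X then 1 else 0 := by
  rw [homDim, finrank_hom_simple_simple]
  have : Nonempty (S.rep ≅ X) ↔ S = SimpleClass.mk X :=
    ⟨fun ⟨e⟩ => SimpleClass.eq_mk_of_iso e, fun h => h ▸ SimpleClass.nonempty_rep_mk_iso X⟩
  simp only [this]
  split_ifs <;> simp

theorem homDim_self (X : C) [Simple X] : homDim X X = 1 := by
  rw [homDim, finrank_endomorphism_simple_eq_one, Nat.cast_one]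

/-- An additive invariant is determined by its values on simple objects. -/
theorem IsAdditive.expand {φ : C → ℝ} (hφ : IsAdditive φ) (X : C) :
    φ X = ∑ S : SimpleClass C, homDim S.rep X * φ S.rep := by
  classical
  obtain ⟨n, T, hT, ⟨e⟩⟩ := IsFusionCategory.semisimple X
  rw [hφ.iso e, hφ.biproduct]
  simp only [fun A => homDim_congr (Iso.refl A) e, (isAdditive_homDim_right _).biproduct,
    Finset.sum_mul]
  rw [Finset.sum_comm]
  refine Finset.sum_congr rfl fun i _ => ?_
  have := hT i
  simp [homDim_rep_simple, hφ.map_rep_mk]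

theorem IsAdditive.nonneg {φ : C → ℝ} (hφ : IsAdditive φ) (h : ∀ S : SimpleClass C, 0 ≤ φ S.rep)
    (X : C) : 0 ≤ φ X := by
  rw [hφ.expand]
  exact Finset.sum_nonneg fun S _ => mul_nonneg (homDim_nonneg _ _) (h S)

theorem IsAdditive.ext {φ ψ : C → ℝ} (hφ : IsAdditive φ) (hψ : IsAdditive ψ)
    (h : ∀ S : SimpleClass C, φ S.rep = ψ S.rep) (X : C) : φ X = ψ X := by
  rw [hφ.expand, hψ.expand]
  simp only [h]

theorem IsAdditive.congr {φ : C → ℝ} (hφ : IsAdditive φ) {X Y : C}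
    (h : ∀ S : SimpleClass C, homDim S.rep X = homDim S.rep Y) : φ X = φ Y := by
  rw [hφ.expand X, hφ.expand Y]
  simp only [h]

/-- A nonnegative additive invariant is monotone: it is at least its value on a simple factor. -/
theorem IsAdditive.homDim_mul_le {φ : C → ℝ} (hφ : IsAdditive φ)
    (h : ∀ S : SimpleClass C, 0 ≤ φ S.rep) (S X : C) [Simple S] : homDim S X * φ S ≤ φ X := by
  rw [hφ.expand X, ← hφ.map_rep_mk S, ← (isAdditive_homDim_left X).map_rep_mk S]
  exact Finset.single_le_sum (f := fun T : SimpleClass C => homDim T.rep X * φ T.rep)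
    (fun T _ => mul_nonneg (homDim_nonneg _ _) (h T)) (Finset.mem_univ _)

theorem exists_homDim_pos_of_pos {φ : C → ℝ} (hφ : IsAdditive φ) {X : C} (h : 0 < φ X) :
    ∃ S : SimpleClass C, 0 < homDim S.rep X ∧ φ S.rep ≠ 0 := by
  rw [hφ.expand] at h
  obtain ⟨S, -, hS⟩ := Finset.exists_ne_zero_of_sum_ne_zero h.ne'
  exact ⟨S, (homDim_nonneg _ _).lt_of_ne' (left_ne_zero_of_mul hS), right_ne_zero_of_mul hS⟩

theorem homDim_comm (X Y : C) : homDim X Y = homDim Y X := by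
  refine (isAdditive_homDim_right X).ext (isAdditive_homDim_left X) (fun S => ?_) Y
  refine (isAdditive_homDim_left S.rep).ext (isAdditive_homDim_right S.rep) (fun T => ?_) X
  rw [homDim_rep_simple, homDim_rep_simple, SimpleClass.mk_rep, SimpleClass.mk_rep]
  by_cases h : S = T
  · simp [h]
  · simp [h, Ne.symm h]

theorem homDim_eq_sum (X Y : C) :
    homDim X Y = ∑ S : SimpleClass C, homDim S.rep X * homDim S.rep Y := by
  rw [(isAdditive_homDim_left Y).expand X]

theorem homDim_pos_iff (S : C) [Simple S] (X : C) : 0 < homDim S X ↔ ∃ f : S ⟶ X, Mono f := by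
  rw [homDim, Nat.cast_pos, Module.finrank_pos_iff_exists_ne_zero]
  constructor
  · rintro ⟨f, hf⟩
    exact ⟨f, mono_of_nonzero_from_simple hf⟩
  · rintro ⟨f, hf⟩
    refine ⟨f, ?_⟩
    rintro rfl
    exact id_nonzero S (zero_of_comp_mono (0 : S ⟶ X) (by simp))

theorem mem_simpleFactors_iff (S : SimpleClass C) (X : C) :
    S ∈ simpleFactors X ↔ 0 < homDim S.rep X :=
  (homDim_pos_iff S.rep X).symm

theorem homDim_pos_iff_exists (X Y : C) :
    0 < homDim X Y ↔ (simpleFactors X ∩ simpleFactors Y).Nonempty := by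
  constructor
  · intro h
    obtain ⟨S, h1, h2⟩ := exists_homDim_pos_of_pos (isAdditive_homDim_left Y) h
    exact ⟨S, (mem_simpleFactors_iff _ _).2 h1,
      (mem_simpleFactors_iff _ _).2 ((homDim_nonneg _ _).lt_of_ne' h2)⟩
  · rintro ⟨S, h1, h2⟩
    rw [mem_simpleFactors_iff] at h1 h2
    rw [homDim_eq_sum]
    exact Finset.sum_pos' (fun T _ => mul_nonneg (homDim_nonneg _ _) (homDim_nonneg _ _))
      ⟨S, Finset.mem_univ _, mul_pos h1 h2⟩

/-! ### Duality -/

theorem homDim_unit_tensor_dual (S : C) [Simple S] : homDim (𝟙_ C) (S ⊗ Sᘁ) = 1 := by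
  rw [← homDim_tensor_right _ S Sᘁ, homDim_congr (λ_ S) (Iso.refl S), homDim_self]

/-- Any simple object `U` is a factor of `S ⊗ Z` for some simple object `Z`: the object
`S ⊗ Sᘁ ⊗ U` contains `𝟙 ⊗ U`. -/
theorem exists_homDim_tensor_pos (S U : C) [Simple S] [Simple U] :
    ∃ Z : SimpleClass C, 0 < homDim U (S ⊗ Z.rep) := by
  have h1 : homDim (𝟙_ C) (S ⊗ Sᘁ) * homDim U (𝟙_ C ⊗ U) ≤ homDim U ((S ⊗ Sᘁ) ⊗ U) :=
    ((isAdditive_homDim_right U).tensor_right U).homDim_mul_le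
      (fun _ => homDim_nonneg _ _) (𝟙_ C) (S ⊗ Sᘁ)
  rw [homDim_unit_tensor_dual, homDim_congr (Iso.refl U) (λ_ U), homDim_self,
    homDim_congr (Iso.refl U) (α_ S Sᘁ U), mul_one] at h1
  obtain ⟨Z, -, hZ⟩ := exists_homDim_pos_of_pos ((isAdditive_homDim_right U).tensor_left S)
    (one_pos.trans_le h1)
  exact ⟨Z, (homDim_nonneg _ _).lt_of_ne' hZ⟩

/-! ### The Frobenius-Perron dimension -/

theorem leftMul_apply (X : C) (w : VirtualObject C) (U : SimpleClass C) :
    leftMul X w U = ∑ S, w S * (homDim U.rep (X ⊗ S.rep) : ℂ) := by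
  rw [leftMul, Finsupp.linearCombination_apply, Finsupp.sum_fintype _ _ (by simp)]
  simp [Finsupp.finsetSum_apply, objClass, homDim]

theorem hasEigenvalue_leftMul {χ : C → ℝ} (hχ : IsAdditive χ)
    (hpos : ∀ S : SimpleClass C, 0 < χ S.rep) {X : C} {μ : ℝ}
    (h : ∀ S : SimpleClass C, χ (X ⊗ S.rep) = μ * χ S.rep) :
    (leftMul X).HasEigenvalue (μ : ℂ) := by
  let S₀ : SimpleClass C := SimpleClass.mk (𝟙_ C)
  -- The functional `∑ w_S [S] ↦ ∑ w_S χ(S)` kills the range of `leftMul X - μ`.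
  let l : VirtualObject C →ₗ[ℂ] ℂ :=
    Finsupp.linearCombination ℂ fun S : SimpleClass C => (χ S.rep : ℂ)
  have hl : ∀ w, l w = ∑ S, w S * (χ S.rep : ℂ) := fun w => by
    simp only [l]
    rw [Finsupp.linearCombination_apply, Finsupp.sum_fintype _ _ (by simp)]
    simp
  have hlL : ∀ w, l (leftMul X w) = μ * l w := fun w => by
    simp only [hl, leftMul_apply, Finset.sum_mul, Finset.mul_sum]
    rw [Finset.sum_comm]
    refine Finset.sum_congr rfl fun S _ => ?_
    have := congrArg (fun t : ℝ => w S * (t : ℂ)) ((hχ.expand (X ⊗ S.rep)).symm.trans (h S))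
    simp only [Complex.ofReal_sum, Complex.ofReal_mul, Finset.mul_sum] at this
    rw [← mul_assoc, mul_comm (μ : ℂ), mul_assoc, ← this]
    exact Finset.sum_congr rfl fun U _ => by ring
  rw [Module.End.hasEigenvalue_iff, Module.End.eigenspace_def, Ne, LinearMap.ker_eq_bot,
    LinearMap.injective_iff_surjective]
  intro hsurj
  obtain ⟨w, hw⟩ := hsurj (Finsupp.single S₀ 1)
  have h1 := congrArg l hw
  rw [LinearMap.sub_apply, map_sub, hlL, LinearMap.smul_apply, Module.End.one_apply, map_smul,
    smul_eq_mul, sub_self] at h1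
  simp only [l, Finsupp.linearCombination_single, one_smul] at h1
  exact (hpos S₀).ne' (Complex.ofReal_eq_zero.1 h1.symm)

theorem le_of_hasEigenvalue_leftMul {χ : C → ℝ} (hχ : IsAdditive χ)
    (hpos : ∀ S : SimpleClass C, 0 < χ S.rep) {X : C} {μ : ℝ}
    (h : ∀ S : SimpleClass C, χ (X ⊗ S.rep) = μ * χ S.rep) {t : ℝ} (ht : 0 ≤ t)
    (hte : (leftMul X).HasEigenvalue (t : ℂ)) : t ≤ μ := by
  obtain ⟨w, hw⟩ := hte.exists_hasEigenvector
  refine le_of_pos_left_eigenvector (B := fun U S : SimpleClass C => homDim U.rep (X ⊗ S.rep))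
    (fun _ _ => homDim_nonneg _ _) hpos (fun S => ?_) ht (z := w) (fun h0 => hw.2 ?_) fun U => ?_
  · rw [← hχ.expand, h]
  · exact DFunLike.coe_injective h0
  · rw [← leftMul_apply, hw.apply_eq_smul, Finsupp.smul_apply, smul_eq_mul]

/-- An additive invariant `χ`, positive on simple objects, with `χ (X ⊗ S) = μ χ S` for all simple
`S` is a positive left eigenvector of the nonnegative matrix of left multiplication by `[X]`, so
`μ` is the spectral radius of this matrix. -/
theorem FPdim_eq_of_isAdditive {χ : C → ℝ} (hχ : IsAdditive χ)
    (hpos : ∀ S : SimpleClass C, 0 < χ S.rep) {X : C} {μ : ℝ}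
    (h : ∀ S : SimpleClass C, χ (X ⊗ S.rep) = μ * χ S.rep) : FPdim X = μ := by
  have hμ : 0 ≤ μ := by
    have h1 := hχ.nonneg (fun S => (hpos S).le) (X ⊗ (SimpleClass.mk (𝟙_ C)).rep)
    rw [h] at h1
    exact nonneg_of_mul_nonneg_left h1 (hpos _)
  have hgreatest : IsGreatest {t : ℝ | 0 ≤ t ∧ (leftMul X).HasEigenvalue (t : ℂ)} μ :=
    ⟨⟨hμ, hasEigenvalue_leftMul hχ hpos h⟩,
      fun t ht => le_of_hasEigenvalue_leftMul hχ hpos h ht.1 ht.2⟩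
  exact hgreatest.csSup_eq

theorem isAdditive_extension (w : SimpleClass C → ℝ) :
    IsAdditive fun X : C => ∑ S : SimpleClass C, homDim S.rep X * w S :=
  IsAdditive.sum fun S => by
    simpa only [mul_comm] using (isAdditive_homDim_right S.rep).const_mul (w S)

/-- There is a positive additive invariant `w` such that `w (X ⊗ Y) = FPdim X * w Y`. On simple
objects it is the Perron-Frobenius eigenvector of the sum of all right multiplications by simple
objects, whose matrix is positive and which commutes with all left multiplications. -/
theorem exists_isAdditive_FPdim_mul (C : Type u) [Category.{v} C] [Abelian C] [Linear ℂ C]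
    [MonoidalCategory C] [MonoidalPreadditive C] [MonoidalLinear ℂ C] [RigidCategory C]
    [IsFusionCategory C] :
    ∃ w : C → ℝ, IsAdditive w ∧ (∀ S : SimpleClass C, 0 < w S.rep) ∧
      ∀ X Y : C, w (X ⊗ Y) = FPdim X * w Y := by
  classical
  have : Nonempty (SimpleClass C) := ⟨SimpleClass.mk (𝟙_ C)⟩
  let A : SimpleClass C → SimpleClass C → ℝ := fun S U =>
    ∑ Z : SimpleClass C, homDim U.rep (S.rep ⊗ Z.rep)
  have hA : ∀ S U, 0 < A S U := fun S U => by
    obtain ⟨Z, hZ⟩ := exists_homDim_tensor_pos S.rep U.rep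
    exact Finset.sum_pos' (fun _ _ => homDim_nonneg _ _) ⟨Z, Finset.mem_univ _, hZ⟩
  obtain ⟨w, r, hw, hAw⟩ := exists_pos_eigenvector A hA
  let χ : C → ℝ := fun X => ∑ S : SimpleClass C, homDim S.rep X * w S
  have hχ : IsAdditive χ := isAdditive_extension w
  have hχw : ∀ S : SimpleClass C, χ S.rep = w S := fun S => by
    simp [χ, homDim_rep_simple, SimpleClass.mk_rep]
  have hAφ : ∀ φ : C → ℝ, IsAdditive φ → ∀ S : SimpleClass C,
      ∑ U, A S U * φ U.rep = ∑ Z : SimpleClass C, φ (S.rep ⊗ Z.rep) := fun φ hφ S => by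
    simp only [A, Finset.sum_mul]
    rw [Finset.sum_comm]
    exact Finset.sum_congr rfl fun Z _ => (hφ.expand _).symm
  have hr : ∀ X : C, ∑ Z : SimpleClass C, χ (X ⊗ Z.rep) = r * χ X := by
    refine (IsAdditive.sum fun Z : SimpleClass C => hχ.tensor_right Z.rep).ext
      (hχ.const_mul r) fun S => ?_
    rw [← hAφ χ hχ, hχw, ← hAw]
    simp only [hχw]
  have hμ : ∀ X : C, ∃ μ : ℝ, ∀ S : SimpleClass C, χ (X ⊗ S.rep) = μ * w S := fun X => by
    -- `S ↦ χ (X ⊗ S)` is an eigenvector of `A` for the same eigenvalue `r`.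
    refine eq_smul_of_eigenvector hA hw hAw fun S => ?_
    rw [hAφ _ (hχ.tensor_left X), ← hr]
    exact Finset.sum_congr rfl fun Z _ => hχ.iso (α_ _ _ _).symm
  have hpos : ∀ S : SimpleClass C, 0 < χ S.rep := fun S => (hχw S).symm ▸ hw S
  refine ⟨χ, hχ, hpos, fun X => ?_⟩
  obtain ⟨μ, hμ⟩ := hμ X
  simp only [← hχw] at hμ
  rw [FPdim_eq_of_isAdditive hχ hpos hμ]
  exact (hχ.tensor_left X).ext (hχ.const_mul μ) hμ

theorem FPdim_eq_div {w : C → ℝ} (hw : IsAdditive w) (hpos : ∀ S : SimpleClass C, 0 < w S.rep)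
    (h : ∀ X Y : C, w (X ⊗ Y) = FPdim X * w Y) : (FPdim : C → ℝ) = fun X => (w (𝟙_ C))⁻¹ * w X := by
  have h1 : 0 < w (𝟙_ C) := by
    rw [← hw.map_rep_mk]
    exact hpos _
  funext X
  rw [← hw.iso (ρ_ X), h]
  field_simp

variable (C) in
theorem isAdditive_FPdim : IsAdditive (FPdim : C → ℝ) := by
  obtain ⟨w, hw, hpos, h⟩ := exists_isAdditive_FPdim_mul C
  rw [FPdim_eq_div hw hpos h]
  exact hw.const_mul _

theorem FPdim_tensor (X Y : C) : FPdim (X ⊗ Y) = FPdim X * FPdim Y := by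
  obtain ⟨w, hw, hpos, h⟩ := exists_isAdditive_FPdim_mul C
  have h1 := congrFun (FPdim_eq_div hw hpos h)
  rw [h1 (X ⊗ Y), h, h1 Y]
  ring

theorem FPdim_pos (X : C) [Simple X] : 0 < FPdim X := by
  obtain ⟨w, hw, hpos, h⟩ := exists_isAdditive_FPdim_mul C
  rw [congrFun (FPdim_eq_div hw hpos h) X, ← hw.map_rep_mk (𝟙_ C), ← hw.map_rep_mk X]
  exact mul_pos (inv_pos.2 (hpos _)) (hpos _)

theorem FPdim_unit : FPdim (𝟙_ C) = 1 := by
  have h := FPdim_tensor (𝟙_ C) (𝟙_ C)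
  rw [(isAdditive_FPdim C).iso (λ_ (𝟙_ C))] at h
  have := FPdim_pos (𝟙_ C)
  nlinarith

end Semisimple

/-! ### Tensor functors and their right adjoints -/

open Functor.LaxMonoidal Functor.OplaxMonoidal in
/-- A monoidal functor preserves duals. -/
@[reducible] def exactPairingMap {C : Type u₁} [Category.{v₁} C] [MonoidalCategory C]
    {D : Type u₂} [Category.{v₂} D] [MonoidalCategory D] (F : C ⥤ D) [F.Monoidal] (X Y : C)
    [ExactPairing X Y] : ExactPairing (F.obj X) (F.obj Y) where
  coevaluation' := ε F ≫ F.map (η_ X Y) ≫ δ F X Y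
  evaluation' := μ F Y X ≫ F.map (ε_ X Y) ≫ η F
  coevaluation_evaluation' := by
    have h := congrArg F.map (ExactPairing.coevaluation_evaluation X Y)
    simp only [Functor.map_comp, Functor.Monoidal.map_whiskerLeft,
      Functor.Monoidal.map_whiskerRight, Functor.Monoidal.map_associator_inv,
      Functor.Monoidal.map_rightUnitor, Functor.Monoidal.map_leftUnitor_inv, Category.assoc,
      Functor.Monoidal.μ_δ_assoc] at h
    simpa only [MonoidalCategory.whiskerLeft_comp, MonoidalCategory.comp_whiskerRight,
      Category.assoc, Functor.Monoidal.μ_δ_assoc, Functor.Monoidal.whiskerLeft_ε_η_assoc,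
      Functor.Monoidal.whiskerRight_ε_η_assoc, Functor.Monoidal.whiskerLeft_ε_η,
      Functor.Monoidal.whiskerRight_ε_η, Category.comp_id] using
      F.obj Y ◁ ε F ≫= μ F Y (𝟙_ C) ≫= h =≫ (δ F (𝟙_ C) Y ≫ η F ▷ F.obj Y)
  evaluation_coevaluation' := by
    have h := congrArg F.map (ExactPairing.evaluation_coevaluation X Y)
    simp only [Functor.map_comp, Functor.Monoidal.map_whiskerLeft,
      Functor.Monoidal.map_whiskerRight, Functor.Monoidal.map_associator,
      Functor.Monoidal.map_leftUnitor, Functor.Monoidal.map_rightUnitor_inv, Category.assoc,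
      Functor.Monoidal.μ_δ_assoc] at h
    simpa only [MonoidalCategory.whiskerLeft_comp, MonoidalCategory.comp_whiskerRight,
      Category.assoc, Functor.Monoidal.μ_δ_assoc, Functor.Monoidal.whiskerLeft_ε_η_assoc,
      Functor.Monoidal.whiskerRight_ε_η_assoc, Functor.Monoidal.whiskerLeft_ε_η,
      Functor.Monoidal.whiskerRight_ε_η, Category.comp_id] using
      ε F ▷ F.obj X ≫= μ F (𝟙_ C) X ≫= h =≫ (δ F X (𝟙_ C) ≫ F.obj X ◁ η F)

theorem homDim_adj {C : Type u₁} [Category.{v₁} C] [Preadditive C] [Linear ℂ C]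
    {D : Type u₂} [Category.{v₂} D] [Preadditive D] [Linear ℂ D] {F : C ⥤ D} [F.Additive]
    [F.Linear ℂ] {R : D ⥤ C} (adj : F ⊣ R) (X : C) (Y : D) :
    homDim (F.obj X) Y = homDim X (R.obj Y) := by
  have e : (X ⟶ R.obj Y) ≃ₗ[ℂ] (F.obj X ⟶ Y) :=
    { (adj.homEquiv X Y).symm with
      map_add' := fun f g => by simp [Adjunction.homEquiv_counit]
      map_smul' := fun c f => by simp [Adjunction.homEquiv_counit, Functor.map_smul] }
  rw [homDim, homDim, e.finrank_eq]

section Normal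

variable {C : Type u₁} [Category.{v₁} C] [Abelian C] [Linear ℂ C]
  [MonoidalCategory C] [MonoidalPreadditive C] [MonoidalLinear ℂ C] [RigidCategory C]
  [IsFusionCategory C]
  {D : Type u₂} [Category.{v₂} D] [Abelian D] [Linear ℂ D]
  [MonoidalCategory D] [MonoidalPreadditive D] [MonoidalLinear ℂ D] [RigidCategory D]
  [IsFusionCategory D]

theorem FPdim_nonneg (X : C) : 0 ≤ FPdim X :=
  (isAdditive_FPdim C).nonneg (fun S => (FPdim_pos S.rep).le) X

/-- An object of Frobenius-Perron dimension zero has no simple factors. -/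
theorem IsAdditive.eq_zero_of_FPdim_eq_zero {φ : C → ℝ} (hφ : IsAdditive φ) {X : C}
    (h : FPdim X = 0) : φ X = 0 := by
  rw [(isAdditive_FPdim C).expand, Finset.sum_eq_zero_iff_of_nonneg
    fun S _ => mul_nonneg (homDim_nonneg _ _) (FPdim_pos S.rep).le] at h
  rw [hφ.expand]
  refine Finset.sum_eq_zero fun S hS => ?_
  rw [(mul_eq_zero.1 (h S hS)).resolve_right (FPdim_pos S.rep).ne', zero_mul]

theorem FPdim_pos_of_homDim_pos {X Y : C} (h : 0 < homDim X Y) : 0 < FPdim X :=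
  (FPdim_nonneg X).lt_of_ne' fun h0 =>
    h.ne' ((isAdditive_homDim_left Y).eq_zero_of_FPdim_eq_zero h0)

/-- A tensor functor `F` preserves Frobenius-Perron dimensions: `FPdim ∘ F` is a positive
multiplicative invariant. -/
theorem FPdim_map (F : C ⥤ D) [F.Additive] [F.Monoidal] (X : C) :
    FPdim (F.obj X) = FPdim X := by
  have hχ : IsAdditive fun X => FPdim (F.obj X) := (isAdditive_FPdim D).comp F
  have hmul : ∀ X Y : C, FPdim (F.obj (X ⊗ Y)) = FPdim (F.obj X) * FPdim (F.obj Y) :=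
    fun X Y => by
      rw [← FPdim_tensor, (isAdditive_FPdim D).iso (Functor.Monoidal.μIso F X Y)]
  refine (FPdim_eq_of_isAdditive hχ (fun S => ?_) fun S => hmul X S.rep).symm
  -- As `𝟙` is a factor of `S ⊗ Sᘁ`, the product `FPdim (F S) * FPdim (F Sᘁ)` is at least `1`.
  have h1 := hχ.homDim_mul_le (fun _ => FPdim_nonneg _) (𝟙_ C) (S.rep ⊗ S.repᘁ)
  rw [homDim_unit_tensor_dual, hmul, ← (isAdditive_FPdim D).iso (Functor.Monoidal.εIso F),
    FPdim_unit, one_mul] at h1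
  exact (FPdim_nonneg _).lt_of_ne' fun h0 => by
    rw [h0, zero_mul] at h1
    exact absurd h1 (by norm_num)

section Adjoint

variable {F : C ⥤ D} [F.Additive] [F.Linear ℂ] {R : D ⥤ C} (adj : F ⊣ R)
variable [F.Monoidal]
include adj

omit [IsFusionCategory C] [RigidCategory D] [IsFusionCategory D] in
theorem homDim_tensor_rightAdjoint (W X : C) (Z : D) :
    homDim W (X ⊗ R.obj Z) = homDim (F.obj W) (F.obj X ⊗ Z) := by
  let := exactPairingMap F X Xᘁ
  rw [← homDim_tensor_left W X Xᘁ, ← homDim_adj adj,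
    ← homDim_tensor_left (F.obj W) (F.obj X) (F.obj Xᘁ)]
  exact homDim_congr (Functor.Monoidal.μIso F _ _).symm (Iso.refl Z)

omit [RigidCategory D] [IsFusionCategory D] in
/-- The projection formula `R (F X ⊗ Z) ≅ X ⊗ R Z`, at the level of classes. -/
theorem IsAdditive.rightAdjoint_tensor {φ : C → ℝ} (hφ : IsAdditive φ) (X : C) (Z : D) :
    φ (R.obj (F.obj X ⊗ Z)) = φ (X ⊗ R.obj Z) :=
  hφ.congr fun S => by rw [← homDim_adj adj, homDim_tensor_rightAdjoint adj]

theorem one_le_FPdim_rightAdjoint_unit : 1 ≤ FPdim (R.obj (𝟙_ D)) := by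
  have h := (isAdditive_FPdim C).homDim_mul_le (fun S => (FPdim_pos S.rep).le) (𝟙_ C)
    (R.obj (𝟙_ D))
  rwa [← homDim_adj adj, homDim_congr (Functor.Monoidal.εIso F).symm (Iso.refl _), homDim_self,
    FPdim_unit, one_mul] at h

variable (hF : IsNormalFunctor F)
include hF

omit adj [F.Additive] [F.Linear ℂ] [F.Monoidal] in
/-- Normality in numerical form. If `homDim (F X) 𝟙` is nonzero, `F X` consists of that many copies of
the unit object; otherwise both sides vanish. -/
theorem IsAdditive.mul_map_of_normal {φ : D → ℝ} (hφ : IsAdditive φ) (X : C) [Simple X] :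
    homDim (F.obj X) (𝟙_ D) * φ (F.obj X) = homDim (F.obj X) (𝟙_ D) ^ 2 * φ (𝟙_ D) := by
  rcases (homDim_nonneg (F.obj X) (𝟙_ D)).eq_or_lt with h | h
  · simp [← h]
  · have h1 : 0 < homDim (𝟙_ D) (F.obj X) := by rwa [homDim_comm]
    obtain ⟨n, -, ⟨e⟩⟩ := hF X (Nat.cast_pos.1 h1)
    have h2 : ∀ ψ : D → ℝ, IsAdditive ψ → ψ (F.obj X) = n * ψ (𝟙_ D) := fun ψ hψ => by
      rw [hψ.iso e, hψ.biproduct]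
      simp
    rw [h2 φ hφ, h2 _ (isAdditive_homDim_left (𝟙_ D)), homDim_self]
    ring

/-- For a normal functor, `F (R 𝟙)` is a multiple of the unit object. -/
theorem IsAdditive.map_rightAdjoint_unit {φ : D → ℝ} (hφ : IsAdditive φ) :
    φ (F.obj (R.obj (𝟙_ D))) = FPdim (R.obj (𝟙_ D)) * φ (𝟙_ D) := by
  have h : ∀ ψ : D → ℝ, IsAdditive ψ → ψ (F.obj (R.obj (𝟙_ D)))
      = (∑ S : SimpleClass C, homDim (F.obj S.rep) (𝟙_ D) ^ 2) * ψ (𝟙_ D) := fun ψ hψ => by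
    rw [(hψ.comp F).expand, Finset.sum_mul]
    refine Finset.sum_congr rfl fun S _ => ?_
    rw [← homDim_adj adj, hψ.mul_map_of_normal hF]
  rw [h φ hφ, ← FPdim_map F, h _ (isAdditive_FPdim D), FPdim_unit, mul_one]

/-- `F R F X` and `F X ⊗ F (R 𝟙)` have the same class, which is a multiple of that of `F X`. -/
theorem IsAdditive.map_rightAdjoint_map {φ : D → ℝ} (hφ : IsAdditive φ) (X : C) :
    φ (F.obj (R.obj (F.obj X))) = FPdim (R.obj (𝟙_ D)) * φ (F.obj X) := by
  have h1 := (hφ.comp F).rightAdjoint_tensor adj X (𝟙_ D)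
  rw [hφ.iso (F.mapIso (R.mapIso (ρ_ (F.obj X)))), ← hφ.iso (Functor.Monoidal.μIso F _ _),
    (hφ.tensor_left (F.obj X)).map_rightAdjoint_unit adj hF, hφ.iso (ρ_ (F.obj X))] at h1
  exact h1

/-- The statement adjoint to `IsAdditive.map_rightAdjoint_map`. -/
theorem IsAdditive.rightAdjoint_map_rightAdjoint {φ : C → ℝ} (hφ : IsAdditive φ) (Y : D) :
    φ (R.obj (F.obj (R.obj Y))) = FPdim (R.obj (𝟙_ D)) * φ (R.obj Y) := by
  rw [hφ.expand, hφ.expand (R.obj Y), Finset.mul_sum]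
  refine Finset.sum_congr rfl fun S _ => ?_
  rw [← homDim_adj adj, homDim_comm, homDim_adj adj, homDim_comm, ← homDim_adj adj,
    (isAdditive_homDim_left Y).map_rightAdjoint_map adj hF, homDim_adj adj, mul_assoc]

/-! ### Linked simple objects -/

/-- Linked simple objects of `C` have proportional images: the matrix of the `homDim (F S) (F T)` is
symmetric, and both `FPdim` and `φ ∘ F` are eigenvectors for the eigenvalue `FPdim (R 𝟙)`. -/
theorem IsAdditive.map_div_FPdim_eq {φ : D → ℝ} (hφ : IsAdditive φ) {S T : SimpleClass C}
    (h : 0 < homDim (F.obj S.rep) (F.obj T.rep)) :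
    φ (F.obj S.rep) / FPdim S.rep = φ (F.obj T.rep) / FPdim T.rep := by
  have hsum : ∀ ψ : D → ℝ, IsAdditive ψ → ∀ S : SimpleClass C,
      ∑ T : SimpleClass C, homDim (F.obj S.rep) (F.obj T.rep) * ψ (F.obj T.rep)
        = FPdim (R.obj (𝟙_ D)) * ψ (F.obj S.rep) := fun ψ hψ S => by
    rw [← hψ.map_rightAdjoint_map adj hF, (hψ.comp F).expand (R.obj _)]
    exact Finset.sum_congr rfl fun T _ => by rw [homDim_comm, homDim_adj adj]
  exact div_eq_div_of_symmetric (M := fun S T : SimpleClass C => homDim (F.obj S.rep) (F.obj T.rep))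
    (d := fun S => FPdim S.rep) (g := fun S => φ (F.obj S.rep)) (N := FPdim (R.obj (𝟙_ D)))
    (fun _ _ => homDim_nonneg _ _) (fun _ _ => homDim_comm _ _) (fun _ => FPdim_nonneg _)
    (fun S hS => absurd hS (FPdim_pos S.rep).ne')
    (fun S => by simpa only [FPdim_map] using hsum _ (isAdditive_FPdim D) S)
    (hsum φ hφ) h (FPdim_pos _) (FPdim_pos _)

/-- Linked simple objects of `D` have proportional images under `R`, by the same argument; the
weights are `FPdim ∘ R` here, since `FPdim` itself need not be an eigenvector of the matrix of the
`homDim (R S) (R T)` at simple objects killed by `R`. -/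
theorem IsAdditive.rightAdjoint_div_eq {φ : C → ℝ} (hφ : IsAdditive φ) {S T : SimpleClass D}
    (h : 0 < homDim (R.obj S.rep) (R.obj T.rep)) :
    φ (R.obj S.rep) / FPdim (R.obj S.rep) = φ (R.obj T.rep) / FPdim (R.obj T.rep) := by
  have := adj.right_adjoint_additive
  have hsum : ∀ ψ : C → ℝ, IsAdditive ψ → ∀ S : SimpleClass D,
      ∑ T : SimpleClass D, homDim (R.obj S.rep) (R.obj T.rep) * ψ (R.obj T.rep)
        = FPdim (R.obj (𝟙_ D)) * ψ (R.obj S.rep) := fun ψ hψ S => by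
    rw [← hψ.rightAdjoint_map_rightAdjoint adj hF, (hψ.comp R).expand (F.obj _)]
    exact Finset.sum_congr rfl fun T _ => by rw [← homDim_adj adj, homDim_comm]
  exact div_eq_div_of_symmetric (M := fun S T : SimpleClass D => homDim (R.obj S.rep) (R.obj T.rep))
    (d := fun S => FPdim (R.obj S.rep)) (g := fun S => φ (R.obj S.rep))
    (N := FPdim (R.obj (𝟙_ D)))
    (fun _ _ => homDim_nonneg _ _) (fun _ _ => homDim_comm _ _) (fun _ => FPdim_nonneg _)
    (fun S hS => hφ.eq_zero_of_FPdim_eq_zero hS) (hsum _ (isAdditive_FPdim C))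
    (hsum φ hφ) h (FPdim_pos_of_homDim_pos h)
    (FPdim_pos_of_homDim_pos (h.trans_eq (homDim_comm _ _)))

omit hF in
/-- A simple object `Y` is either killed by `R` or satisfies `FPdim (R Y) = FPdim (R 𝟙) * FPdim Y`.
If `Y` maximizes `FPdim (R Y) / FPdim Y`, then by the projection formula so do all simple factors of
`F X ⊗ Y`, and `𝟙` is among these for a suitable `X`; hence `≤` holds for every simple `Y`. It is an
equality for `F X`, hence for all simple factors of `F X`. -/
theorem FPdim_rightAdjoint {Y : D} [Simple Y] (hY : 0 < FPdim (R.obj Y)) :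
    FPdim (R.obj Y) = FPdim (R.obj (𝟙_ D)) * FPdim Y := by
  have := adj.right_adjoint_additive
  have : Nonempty (SimpleClass D) := ⟨SimpleClass.mk (𝟙_ D)⟩
  have he : IsAdditive fun Z => FPdim (R.obj Z) := (isAdditive_FPdim C).comp R
  have heT : ∀ (X : C) (Z : D), FPdim (R.obj (F.obj X ⊗ Z)) = FPdim X * FPdim (R.obj Z) :=
    fun X Z => by rw [(isAdditive_FPdim C).rightAdjoint_tensor adj, FPdim_tensor]
  have hψ : ∀ m : ℝ, IsAdditive fun Z : D => m * FPdim Z - FPdim (R.obj Z) := fun m =>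
    ((isAdditive_FPdim D).const_mul m).sub he
  have hψT : ∀ (m : ℝ) (X : C) (Z : D),
      m * FPdim (F.obj X ⊗ Z) - FPdim (R.obj (F.obj X ⊗ Z))
        = FPdim X * (m * FPdim Z - FPdim (R.obj Z)) := fun m X Z => by
    rw [heT, FPdim_tensor, FPdim_map]
    ring
  obtain ⟨Y₀, hY₀⟩ := Finite.exists_max fun S : SimpleClass D => FPdim (R.obj S.rep) / FPdim S.rep
  set m := FPdim (R.obj Y₀.rep) / FPdim Y₀.rep with hm
  have hψnn : ∀ S : SimpleClass D, 0 ≤ m * FPdim S.rep - FPdim (R.obj S.rep) := fun S =>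
    sub_nonneg.2 ((div_le_iff₀ (FPdim_pos S.rep)).1 (hY₀ S))
  have hψ0 : m * FPdim Y₀.rep - FPdim (R.obj Y₀.rep) = 0 := by
    rw [hm, div_mul_cancel₀ _ (FPdim_pos Y₀.rep).ne', sub_self]
  have hunit : m * FPdim (𝟙_ D) - FPdim (R.obj (𝟙_ D)) ≤ 0 := by
    -- The maximum `m` is positive because `FPdim (R 𝟙)` is, so `R Y₀` is nonzero.
    have hRY₀ : 0 < FPdim (R.obj Y₀.rep) := by
      have h1 := (hψ m).nonneg hψnn (𝟙_ D)
      rw [FPdim_unit, mul_one] at h1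
      have h2 := one_le_FPdim_rightAdjoint_unit adj
      have h3 : 0 < m := by linarith
      exact (div_pos_iff_of_pos_right (FPdim_pos Y₀.rep)).1 h3
    obtain ⟨X, hX, -⟩ := exists_homDim_pos_of_pos (isAdditive_FPdim C) hRY₀
    -- `Y₀` is a factor of `F X`, so `𝟙` is a factor of `F (ᘁX) ⊗ Y₀`, on which the invariant
    -- `m * FPdim Z - FPdim (R Z)` vanishes.
    let := exactPairingMap F (ᘁX.rep) X.rep
    have h1 := (hψ m).homDim_mul_le hψnn (𝟙_ D) (F.obj (ᘁX.rep) ⊗ Y₀.rep)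
    rw [hψT, hψ0, mul_zero, ← homDim_tensor_left (𝟙_ D) (F.obj (ᘁX.rep)) (F.obj X.rep),
      homDim_congr (ρ_ _) (Iso.refl _), homDim_adj adj] at h1
    exact nonpos_of_mul_nonpos_right h1 hX
  have hm1 : m = FPdim (R.obj (𝟙_ D)) := by
    have h1 := (hψ m).nonneg hψnn (𝟙_ D)
    rw [FPdim_unit, mul_one] at h1 hunit
    linarith
  obtain ⟨X, hX, -⟩ := exists_homDim_pos_of_pos (isAdditive_FPdim C) hY
  rw [← homDim_adj adj, homDim_comm] at hX
  have h1 := (hψ m).homDim_mul_le hψnn Y (F.obj X.rep)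
  rw [← (hψ m).iso (ρ_ (F.obj X.rep)), hψT] at h1
  have h2 := nonpos_of_mul_nonpos_right
    (h1.trans (mul_nonpos_of_nonneg_of_nonpos (FPdim_nonneg _) hunit)) hX
  have h3 := (hψ m).nonneg hψnn Y
  rw [← hm1]
  linarith

end Adjoint

end Normal

/-! ### Classes up to proportionality -/

section Classes

variable {C : Type u₁} [Category.{v₁} C] [Abelian C] [Linear ℂ C]
  [MonoidalCategory C] [MonoidalPreadditive C] [MonoidalLinear ℂ C] [RigidCategory C]
  [IsFusionCategory C]

theorem inv_smul_objClass_eq_iff (a b : ℝ) (X Y : C) :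
    (a : ℂ)⁻¹ • objClass X = (b : ℂ)⁻¹ • objClass Y ↔
      ∀ S : SimpleClass C, homDim S.rep X / a = homDim S.rep Y / b := by
  rw [Finsupp.ext_iff]
  refine forall_congr' fun S => ?_
  have h : ∀ (c : ℝ) (Z : C), ((c : ℂ)⁻¹ • objClass Z) S = ((homDim S.rep Z / c : ℝ) : ℂ) :=
    fun c Z => by
      simp [objClass, homDim, div_eq_inv_mul]
  rw [h, h, Complex.ofReal_inj]

theorem exists_homDim_pos_of_not_isZero {X : C} (h : ¬ IsZero X) :
    ∃ S : SimpleClass C, 0 < homDim S.rep X := by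
  have h1 : 0 < homDim X X := Nat.cast_pos.2
    (Module.finrank_pos_iff_exists_ne_zero.2 ⟨𝟙 X, fun h0 => h ((IsZero.iff_id_eq_zero X).2 h0)⟩)
  obtain ⟨S, hS, -⟩ := exists_homDim_pos_of_pos (isAdditive_homDim_left X) h1
  exact ⟨S, hS⟩

theorem linked_iff_homDim_pos {A : Type u} [Category.{v} A] [HasZeroMorphisms A] (G : A ⥤ C)
    (X X' : SimpleClass A) : Linked G X X' ↔ 0 < homDim (G.obj X.rep) (G.obj X'.rep) :=
  (homDim_pos_iff_exists _ _).symm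

/-- Two objects with proportional classes, not both zero, have a common simple factor. -/
theorem homDim_pos_of_div_eq {X Y : C} {a b : ℝ} (ha : 0 < a) (hb : 0 < b)
    (h : ∀ S : SimpleClass C, homDim S.rep X / a = homDim S.rep Y / b)
    (hXY : ¬ IsZero X ∨ ¬ IsZero Y) : 0 < homDim X Y := by
  have hiff : ∀ S : SimpleClass C, 0 < homDim S.rep X ↔ 0 < homDim S.rep Y := fun S => by
    rw [← div_pos_iff_of_pos_right ha, h, div_pos_iff_of_pos_right hb]
  obtain ⟨S, hS⟩ : ∃ S : SimpleClass C, 0 < homDim S.rep X := by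
    rcases hXY with hX | hY
    · exact exists_homDim_pos_of_not_isZero hX
    · obtain ⟨S, hS⟩ := exists_homDim_pos_of_not_isZero hY
      exact ⟨S, (hiff S).2 hS⟩
  exact (homDim_pos_iff_exists _ _).2
    ⟨S, (mem_simpleFactors_iff _ _).2 hS, (mem_simpleFactors_iff _ _).2 ((hiff S).1 hS)⟩

theorem not_isZero_of_FPdim_pos {X : C} (h : 0 < FPdim X) : ¬ IsZero X := fun hX => by
  obtain ⟨S, hS, -⟩ := exists_homDim_pos_of_pos (isAdditive_FPdim C) h
  obtain ⟨f, hf⟩ := (homDim_pos_iff S.rep X).1 hS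
  exact id_nonzero S.rep (zero_of_comp_mono f (hX.eq_of_tgt _ _))

end Classes

/-- A function constant on linked pairs is constant on the classes of the generated equivalence. -/
theorem LinkEquiv.apply_eq {A : Type u₁} [Category.{v₁} A] [HasZeroMorphisms A]
    {B : Type u₂} [Category.{v₂} B] [HasZeroMorphisms B] {G : A ⥤ B} {α : Sort*}
    {f : SimpleClass A → α} (hf : ∀ X X', Linked G X X' → f X = f X') {X X' : SimpleClass A}
    (h : LinkEquiv G X X') : f X = f X' := by
  induction h with
  | refl => rfl
  | tail _ h ih => exact ih.trans (hf _ _ h)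

end FusionImage

end

open FusionImage in
theorem mainTheorem2
    {C : Type u₁} [Category.{v₁} C] [Abelian C] [Linear ℂ C]
    [MonoidalCategory C] [MonoidalPreadditive C] [MonoidalLinear ℂ C] [RigidCategory C]
    [IsFusionCategory C]
    {D : Type u₂} [Category.{v₂} D] [Abelian D] [Linear ℂ D]
    [MonoidalCategory D] [MonoidalPreadditive D] [MonoidalLinear ℂ D] [RigidCategory D]
    [IsFusionCategory D]
    (F : C ⥤ D) [F.Additive] [F.Linear ℂ] [F.Monoidal] (hF : IsNormalFunctor F)
    (R : D ⥤ C) (adj : F ⊣ R) :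
    (∀ (X X' : C) [Simple X] [Simple X'],
      LinkEquiv F (SimpleClass.mk X) (SimpleClass.mk X') ↔
        (FPdim X : ℂ)⁻¹ • objClass (F.obj X) = (FPdim X' : ℂ)⁻¹ • objClass (F.obj X')) ∧
    (∀ (Y Y' : D) [Simple Y] [Simple Y'],
      (LinkEquiv R (SimpleClass.mk Y) (SimpleClass.mk Y') →
        (FPdim Y : ℂ)⁻¹ • objClass (R.obj Y) = (FPdim Y' : ℂ)⁻¹ • objClass (R.obj Y')) ∧
      (¬ IsZero (R.obj Y) ∨ ¬ IsZero (R.obj Y') →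
        (LinkEquiv R (SimpleClass.mk Y) (SimpleClass.mk Y') ↔
          (FPdim Y : ℂ)⁻¹ • objClass (R.obj Y) = (FPdim Y' : ℂ)⁻¹ • objClass (R.obj Y')))) := by
  have hRadd := adj.right_adjoint_additive
  refine ⟨fun X X' _ _ => ?_, fun Y Y' _ _ => ?_⟩
  · rw [inv_smul_objClass_eq_iff]
    constructor
    · intro h S
      have h1 := h.apply_eq (f := fun T => homDim S.rep (F.obj T.rep) / FPdim T.rep)
        fun T T' hT => (isAdditive_homDim_right S.rep).map_div_FPdim_eq adj hF
          ((linked_iff_homDim_pos F T T').1 hT)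
      simpa only [((isAdditive_homDim_right S.rep).comp F).map_rep_mk,
        (isAdditive_FPdim C).map_rep_mk] using h1
    · intro h
      refine Relation.ReflTransGen.single ((linked_iff_homDim_pos F _ _).2 ?_)
      rw [((isAdditive_homDim_left _).comp F).map_rep_mk,
        ((isAdditive_homDim_right _).comp F).map_rep_mk]
      exact homDim_pos_of_div_eq (FPdim_pos X) (FPdim_pos X') h
        (Or.inl (not_isZero_of_FPdim_pos ((FPdim_map F X).symm ▸ FPdim_pos X)))
  · have key : LinkEquiv R (SimpleClass.mk Y) (SimpleClass.mk Y') →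
        (FPdim Y : ℂ)⁻¹ • objClass (R.obj Y) = (FPdim Y' : ℂ)⁻¹ • objClass (R.obj Y') := by
      rw [inv_smul_objClass_eq_iff]
      intro h S
      have h1 := h.apply_eq (f := fun T => homDim S.rep (R.obj T.rep) / FPdim T.rep)
        fun T T' hT => by
          have hpos := (linked_iff_homDim_pos R T T').1 hT
          have h2 := (isAdditive_homDim_right S.rep).rightAdjoint_div_eq adj hF hpos
          have hN : FPdim (R.obj (𝟙_ D)) ≠ 0 :=
            (one_pos.trans_le (one_le_FPdim_rightAdjoint_unit adj)).ne'
          rw [FPdim_rightAdjoint adj (FPdim_pos_of_homDim_pos hpos),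
            FPdim_rightAdjoint adj (FPdim_pos_of_homDim_pos (hpos.trans_eq (homDim_comm _ _))),
            div_mul_eq_div_div_swap, div_mul_eq_div_div_swap] at h2
          exact (div_left_inj' hN).1 h2
      simpa only [((isAdditive_homDim_right S.rep).comp R).map_rep_mk,
        (isAdditive_FPdim D).map_rep_mk] using h1
    refine ⟨key, fun hne => ⟨key, fun h => ?_⟩⟩
    rw [inv_smul_objClass_eq_iff] at h
    refine Relation.ReflTransGen.single ((linked_iff_homDim_pos R _ _).2 ?_)
    rw [((isAdditive_homDim_left _).comp R).map_rep_mk,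
      ((isAdditive_homDim_right _).comp R).map_rep_mk]
    exact homDim_pos_of_div_eq (FPdim_pos Y) (FPdim_pos Y') h hne
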